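/- For a finite simple graph $G$, the clique cover number $\theta_1(G)$ is the minimum number of cliques of $G$ needed to cover all edges of $G$ (an edge is covered by a clique that contains both of its endpoints). Let $G_{n,p}$ be the random graph on $n$ labelled vertices in which each of the $\binom n2$ possible edges is present independently with probability $p$. **Theorem.** For every constant $p$ with $0<p<1$ there exist constants $c_1=c_1(p)>0$ and $c_2=c_2(p)>0$ such that $$\lim_{n\to\infty}\Pr\left(\frac{c_1 n^2}{(\ln n)^2}\le \theta_1(G_{n,p})\le \frac{c_2 n^2}{(\ln n)^2}\right)=1.$$ -/

import Mathlib

open Filter Topology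

namespace SimpleGraph

/-- A finite family `F` of vertex sets is a clique cover of `G` if every member of `F` is a clique
of `G` and every edge of `G` has both endpoints in some member of `F`. -/
def IsCliqueCover {V : Type*} (G : SimpleGraph V) (F : Finset (Finset V)) : Prop :=
  (∀ K ∈ F, G.IsClique (K : Set V)) ∧ ∀ u v : V, G.Adj u v → ∃ K ∈ F, u ∈ K ∧ v ∈ K

/-- Every graph on a finite vertex set has a clique cover. -/
theorem exists_isCliqueCover {V : Type*} [Finite V] (G : SimpleGraph V) :
    ∃ F : Finset (Finset V), G.IsCliqueCover F := by
  classical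
  cases nonempty_fintype V
  refine ⟨Finset.univ.filter (fun K : Finset V => G.IsClique (K : Set V)), ?_, ?_⟩
  · intro K hK
    exact (Finset.mem_filter.mp hK).2
  · intro u v huv
    refine ⟨{u, v}, ?_, by simp, by simp⟩
    simp [huv]

/-- The clique cover number `θ₁(G)` of a graph on a finite vertex set: the minimum number of
cliques of `G` that together cover all the edges of `G`. -/
noncomputable def cliqueCoverNumber {V : Type*} [Finite V] (G : SimpleGraph V) : ℕ :=
  sInf {k : ℕ | ∃ F : Finset (Finset V), G.IsCliqueCover F ∧ F.card = k}

/-- The minimum in the definition of the clique cover number is attained. -/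
theorem exists_isCliqueCover_card_eq {V : Type*} [Finite V] (G : SimpleGraph V) :
    ∃ F : Finset (Finset V), G.IsCliqueCover F ∧ F.card = G.cliqueCoverNumber := by
  obtain ⟨F, hF⟩ := G.exists_isCliqueCover
  have h : {k : ℕ | ∃ F : Finset (Finset V), G.IsCliqueCover F ∧ F.card = k}.Nonempty :=
    ⟨F.card, F, hF, rfl⟩
  exact Nat.sInf_mem h

end SimpleGraph

namespace SimpleGraph

/-! Write L = ln n and count edges as ordered adjacent pairs. For the lower bound, with high
probability there are at least p n²/2 such pairs and every clique has O(L) vertices, so each clique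
accounts for only O(L²) pairs (`le_cliqueCoverNumber_of_dense`).

For the upper bound, cliques are chosen greedily. Two properties hold with high probability: every
vertex set of size at least n^0.6 has density at least p(1 - 1/(2L²)), and for s ≤ L the number of
ordered s-cliques is at most L² n^s p^(s choose 2). Let H be the graph of uncovered edges, with δn²
ordered pairs and δ ≥ 1/L². By convexity and the density property, the H-neighbourhoods contain many
ordered s-cliques of G in total; since G has few s-cliques, some s-clique has a large common
H-neighbourhood, which by density contains another s-clique. Their union is a clique of G with s²
edges of H (`exists_clique_adjPairs`).

Taking s of order L δ^(1/4) gives a gain of order (L²/n)√|H|. Each step then lowers √|H| by a fixed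
amount of order L²/n, so O(n²/L²) steps suffice; the last n²/L² pairs are covered one edge at a time
(`exists_cover_of_greedy`). -/

open Classical in
/-- The ordered cliques of length `s` of `G` with all vertices in `U`. -/
noncomputable def orderedCliques {V : Type*} [Fintype V] (G : SimpleGraph V) (s : ℕ)
    (U : Finset V) : Finset (Fin s → V) :=
  Finset.univ.filter fun f => (∀ i, f i ∈ U) ∧ ∀ i j, i < j → G.Adj (f i) (f j)

open Classical in
/-- The neighbours of `v` in `G` that lie in `U`. -/
noncomputable def neighborsIn {V : Type*} (G : SimpleGraph V) (U : Finset V) (v : V) : Finset V :=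
  U.filter (G.Adj v)

open Classical in
/-- The ordered pairs of adjacent vertices of `G`. -/
noncomputable def adjPairs {V : Type*} [Fintype V] (G : SimpleGraph V) : Finset (V × V) :=
  Finset.univ.filter fun x => G.Adj x.1 x.2

/-! ### Counting ordered cliques in graphs of locally bounded density -/

section Combinatorics

variable {V : Type*}

theorem mem_neighborsIn {G : SimpleGraph V} {U : Finset V} {v w : V} :
    w ∈ G.neighborsIn U v ↔ w ∈ U ∧ G.Adj v w := by
  simp [neighborsIn]

variable [Fintype V]

theorem mem_orderedCliques {G : SimpleGraph V} {s : ℕ} {U : Finset V} {f : Fin s → V} :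
    f ∈ G.orderedCliques s U ↔ (∀ i, f i ∈ U) ∧ ∀ i j, i < j → G.Adj (f i) (f j) := by
  simp [orderedCliques]

theorem mem_adjPairs {G : SimpleGraph V} {x : V × V} : x ∈ G.adjPairs ↔ G.Adj x.1 x.2 := by
  simp [adjPairs]

theorem orderedCliques_adj {G : SimpleGraph V} {s : ℕ} {U : Finset V} {f : Fin s → V}
    (hf : f ∈ G.orderedCliques s U) {i j : Fin s} (hij : i ≠ j) : G.Adj (f i) (f j) := by
  rcases lt_or_gt_of_ne hij with h | h
  · exact (mem_orderedCliques.1 hf).2 i j h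
  · exact ((mem_orderedCliques.1 hf).2 j i h).symm

theorem orderedCliques_injective {G : SimpleGraph V} {s : ℕ} {U : Finset V} {f : Fin s → V}
    (hf : f ∈ G.orderedCliques s U) : Function.Injective f := by
  intro i j hij
  by_contra hne
  have := orderedCliques_adj hf hne
  rw [hij] at this
  exact G.irrefl this

theorem card_orderedCliques_zero (G : SimpleGraph V) (U : Finset V) :
    (G.orderedCliques 0 U).card = 1 := by
  have : G.orderedCliques 0 U = {Fin.elim0} := by
    ext f
    simp only [mem_orderedCliques, Finset.mem_singleton]
    exact ⟨fun _ => Subsingleton.elim _ _, fun _ => ⟨fun i => i.elim0, fun i => i.elim0⟩⟩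
  simp [this]

/-- Split off the first vertex: the rest is an ordered clique in its neighbourhood. Ordering the
vertices keeps symmetry factors out of the recursion. -/
theorem card_orderedCliques_succ (G : SimpleGraph V) (s : ℕ) (U : Finset V) :
    (G.orderedCliques (s + 1) U).card
      = ∑ v ∈ U, (G.orderedCliques s (G.neighborsIn U v)).card := by
  classical
  rw [← Finset.card_sigma]
  refine Finset.card_bij' (fun f _ => ⟨f 0, fun i => f i.succ⟩)
    (fun x _ => (Fin.cons x.1 x.2 : Fin (s + 1) → V)) ?_ ?_ ?_ ?_
  · intro f hf
    rw [mem_orderedCliques] at hf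
    rw [Finset.mem_sigma]
    refine ⟨hf.1 0, mem_orderedCliques.2 ⟨fun i => mem_neighborsIn.2
      ⟨hf.1 _, hf.2 _ _ (Fin.succ_pos i)⟩, fun i j hij => hf.2 _ _ (Fin.succ_lt_succ_iff.2 hij)⟩⟩
  · rintro ⟨v, g⟩ hx
    rw [Finset.mem_sigma] at hx
    obtain ⟨hv, hg⟩ := hx
    rw [mem_orderedCliques] at hg
    simp only [mem_neighborsIn] at hg
    refine mem_orderedCliques.2 ⟨?_, ?_⟩
    · intro i
      refine Fin.cases ?_ (fun i => ?_) i
      · simpa using hv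
      · simpa using (hg.1 i).1
    · intro i j
      refine Fin.cases ?_ (fun i => ?_) i <;> refine Fin.cases ?_ (fun j => ?_) j
      · simp
      · intro _; simpa using (hg.1 j).2
      · intro h; exact absurd h (Fin.not_lt_zero _)
      · intro h; simpa using hg.2 i j (Fin.succ_lt_succ_iff.1 h)
  · intro f _
    exact Fin.cons_self_tail f
  · rintro ⟨v, g⟩ _
    simp

/-- A power mean inequality. -/
theorem card_mul_pow_le_sum_pow {ι : Type*} (A : Finset ι) (a : ι → ℝ) (t : ℝ)
    (ha : ∀ i ∈ A, 0 ≤ a i) (ht : 0 ≤ t) (h : A.card * t ≤ ∑ i ∈ A, a i) (s : ℕ) :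
    A.card * t ^ s ≤ ∑ i ∈ A, a i ^ s := by
  cases s with
  | zero => simp
  | succ s =>
    rcases A.eq_empty_or_nonempty with rfl | hA
    · simp
    have hc : (0 : ℝ) < A.card := by exact_mod_cast hA.card_pos
    refine le_trans ?_ (pow_sum_div_card_le_sum_pow ha s)
    rw [le_div_iff₀ (by positivity)]
    calc (A.card : ℝ) * t ^ (s + 1) * (A.card : ℝ) ^ s = (A.card * t) ^ (s + 1) := by ring
      _ ≤ _ := pow_le_pow_left₀ (by positivity) h _

/-- If all large vertex sets have edge density at least `q`, then all vertex sets contain about as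
many ordered cliques as expected. -/
theorem le_card_orderedCliques (G : SimpleGraph V) {q m : ℝ} (hq : 0 < q) (hq1 : q ≤ 1)
    (hm : 0 ≤ m)
    (hG : ∀ U : Finset V, m ≤ U.card →
      q * (U.card : ℝ) ^ 2 ≤ ∑ v ∈ U, ((G.neighborsIn U v).card : ℝ))
    (s : ℕ) (U : Finset V) :
    q ^ (s.choose 2) * (max 0 (U.card - m / q ^ s)) ^ s ≤ ((G.orderedCliques s U).card : ℝ) := by
  induction s generalizing U with
  | zero => simp [card_orderedCliques_zero]
  | succ s ih =>
    -- The truncation at 0 makes the bound trivial for sets too small for the density hypothesis.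
    rcases le_or_gt ((U.card : ℝ) - m / q ^ (s + 1)) 0 with h0 | h0
    · rw [max_eq_left h0]
      simp
    rw [max_eq_right h0.le, card_orderedCliques_succ]
    push_cast
    have hqs : 0 < q ^ (s + 1) := by positivity
    have hmU : m ≤ U.card := by
      have : m ≤ m / q ^ (s + 1) := le_div_self hm hqs (pow_le_one₀ hq.le hq1)
      linarith
    have hsum := hG U hmU
    -- The thresholds m/q^s are chosen so that q(|U| - m/q^(s+1)) = q|U| - m/q^s: this is at most
    -- the average excess of a neighbourhood over the next threshold, and convexity applies.
    have key := card_mul_pow_le_sum_pow U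
      (fun v => max 0 (((G.neighborsIn U v).card : ℝ) - m / q ^ s))
      (q * (U.card - m / q ^ (s + 1))) (fun _ _ => le_max_left _ _) (by positivity) (by
        have h1 : ∑ v ∈ U, (((G.neighborsIn U v).card : ℝ) - m / q ^ s)
            ≤ ∑ v ∈ U, max 0 (((G.neighborsIn U v).card : ℝ) - m / q ^ s) :=
          Finset.sum_le_sum fun _ _ => le_max_right _ _
        refine le_trans ?_ h1
        rw [Finset.sum_sub_distrib, Finset.sum_const, nsmul_eq_mul]
        have h2 : q * (m / q ^ (s + 1)) = m / q ^ s := by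
          rw [pow_succ]
          field_simp
        calc (U.card : ℝ) * (q * (U.card - m / q ^ (s + 1)))
            = q * (U.card : ℝ) ^ 2 - U.card * (q * (m / q ^ (s + 1))) := by ring
          _ ≤ _ := by rw [h2]; linarith) s
    calc q ^ ((s + 1).choose 2) * ((U.card : ℝ) - m / q ^ (s + 1)) ^ (s + 1)
        = q ^ (s.choose 2) * (((U.card : ℝ) - m / q ^ (s + 1)) *
            (q * ((U.card : ℝ) - m / q ^ (s + 1))) ^ s) := by
          have : (s + 1).choose 2 = s + s.choose 2 := by
            rw [Nat.choose_succ_succ' s 1, Nat.choose_one_right]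
          rw [this, pow_add, mul_pow]; ring
      _ ≤ q ^ (s.choose 2) * ((U.card : ℝ) * (q * ((U.card : ℝ) - m / q ^ (s + 1))) ^ s) := by
          have : 0 ≤ m / q ^ (s + 1) := by positivity
          gcongr
          linarith
      _ ≤ q ^ (s.choose 2) *
            ∑ v ∈ U, (max 0 (((G.neighborsIn U v).card : ℝ) - m / q ^ s)) ^ s := by
          gcongr
      _ = ∑ v ∈ U, q ^ (s.choose 2) *
            (max 0 (((G.neighborsIn U v).card : ℝ) - m / q ^ s)) ^ s := Finset.mul_sum _ _ _
      _ ≤ _ := Finset.sum_le_sum fun v _ => ih _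

-- Double counting of pairs (v, f) with f a clique of G inside the H-neighbourhood of v.
open Classical in
theorem sum_card_orderedCliques_neighborsIn (G H : SimpleGraph V) (s : ℕ) :
    ∑ v, (G.orderedCliques s (H.neighborsIn Finset.univ v)).card
      = ∑ f ∈ G.orderedCliques s Finset.univ,
          (Finset.univ.filter fun v => ∀ i, H.Adj v (f i)).card := by
  have h : ∀ v, G.orderedCliques s (H.neighborsIn Finset.univ v)
      = (G.orderedCliques s Finset.univ).filter fun f => ∀ i, H.Adj v (f i) := by
    intro v
    ext f
    simp [mem_orderedCliques, mem_neighborsIn, and_comm]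
  simp_rw [h, Finset.card_filter]
  exact Finset.sum_comm

theorem sum_card_neighborsIn (H : SimpleGraph V) :
    ∑ v, (H.neighborsIn Finset.univ v).card = H.adjPairs.card := by
  classical
  simp only [neighborsIn, adjPairs, Finset.card_filter]
  rw [← Finset.univ_product_univ, Finset.sum_product]

open Classical in
/-- A dense subgraph `H` of a graph `G` with good clique counts admits a clique of `G` containing
many edges of `H`. -/
theorem exists_clique_adjPairs {G H : SimpleGraph V} (hHG : H ≤ G) {q m Y : ℝ} {s : ℕ}
    (hq : 0 < q) (hq1 : q ≤ 1) (hm : 0 ≤ m)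
    (hG : ∀ U : Finset V, m ≤ U.card →
      q * (U.card : ℝ) ^ 2 ≤ ∑ v ∈ U, ((G.neighborsIn U v).card : ℝ))
    (hY : ((G.orderedCliques s Finset.univ).card : ℝ) ≤ Y)
    (hd : m / q ^ s ≤ (H.adjPairs.card : ℝ) / Fintype.card V)
    (hbig : (m / q ^ s) * Y < q ^ (s.choose 2) * (Fintype.card V *
      ((H.adjPairs.card : ℝ) / Fintype.card V - m / q ^ s) ^ s)) :
    ∃ K : Finset V, G.IsClique (K : Set V) ∧
      s ^ 2 ≤ (H.adjPairs.filter fun x => x.1 ∈ K ∧ x.2 ∈ K).card := by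
  have hM : 0 ≤ m / q ^ s := by positivity
  rcases Nat.eq_zero_or_pos (Fintype.card V) with hV | hV
  · exfalso
    have : 0 ≤ (m / q ^ s) * Y := mul_nonneg hM (le_trans (Nat.cast_nonneg _) hY)
    simp [hV] at hbig
    linarith
  have hV' : (0 : ℝ) < Fintype.card V := by exact_mod_cast hV
  -- If every s-clique had at most m/q^s common H-neighbours, the double count would be at most
  -- (m/q^s)Y, against the convexity lower bound.
  obtain ⟨f, hf, hfM⟩ : ∃ f ∈ G.orderedCliques s Finset.univ, m / q ^ s <
      ((Finset.univ.filter fun v => ∀ i, H.Adj v (f i)).card : ℝ) := by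
    by_contra! hcon
    have h1 : ∑ f ∈ G.orderedCliques s Finset.univ,
        ((Finset.univ.filter fun v => ∀ i, H.Adj v (f i)).card : ℝ) ≤ (m / q ^ s) * Y := by
      refine (Finset.sum_le_sum hcon).trans ?_
      rw [Finset.sum_const, nsmul_eq_mul, mul_comm]
      gcongr
    have h2 : ∑ v, ((G.orderedCliques s (H.neighborsIn Finset.univ v)).card : ℝ)
      = ∑ f ∈ G.orderedCliques s Finset.univ,
          ((Finset.univ.filter fun v => ∀ i, H.Adj v (f i)).card : ℝ) := by
      exact_mod_cast sum_card_orderedCliques_neighborsIn G H s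
    have h3 := card_mul_pow_le_sum_pow Finset.univ
      (fun v => max 0 (((H.neighborsIn Finset.univ v).card : ℝ) - m / q ^ s))
      ((H.adjPairs.card : ℝ) / Fintype.card V - m / q ^ s) (fun _ _ => le_max_left _ _)
      (by linarith) (by
        have : ∑ v, (((H.neighborsIn Finset.univ v).card : ℝ) - m / q ^ s)
            ≤ ∑ v, max 0 (((H.neighborsIn Finset.univ v).card : ℝ) - m / q ^ s) :=
          Finset.sum_le_sum fun _ _ => le_max_right _ _
        refine le_trans (le_of_eq ?_) this
        rw [Finset.sum_sub_distrib, Finset.sum_const, nsmul_eq_mul, ← Nat.cast_sum,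
          sum_card_neighborsIn, Finset.card_univ]
        field_simp) s
    have h4 : q ^ (s.choose 2) * ∑ v,
        (max 0 (((H.neighborsIn Finset.univ v).card : ℝ) - m / q ^ s)) ^ s ≤
        ∑ v, ((G.orderedCliques s (H.neighborsIn Finset.univ v)).card : ℝ) := by
      rw [Finset.mul_sum]
      exact Finset.sum_le_sum fun v _ => le_card_orderedCliques G hq hq1 hm hG s _
    rw [Finset.card_univ] at h3
    have h5 := mul_le_mul_of_nonneg_left h3 (pow_nonneg hq.le (s.choose 2))
    linarith
  set B := Finset.univ.filter fun v => ∀ i, H.Adj v (f i) with hB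
  obtain ⟨g, hg⟩ : (G.orderedCliques s B).Nonempty := by
    rw [← Finset.card_pos]
    have h := le_card_orderedCliques G hq hq1 hm hG s B
    have hpos : 0 < (B.card : ℝ) - m / q ^ s := by linarith
    rw [max_eq_right hpos.le] at h
    have : (0 : ℝ) < ((G.orderedCliques s B).card : ℝ) := lt_of_lt_of_le (by positivity) h
    exact_mod_cast this
  have hgf : ∀ i j, H.Adj (g i) (f j) := fun i j => by
    have := (mem_orderedCliques.1 hg).1 i
    simp only [hB, Finset.mem_filter] at this
    exact this.2 j
  -- Each g i is H-adjacent to each f j, which gives s² distinct ordered pairs of H.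
  refine ⟨Finset.univ.image g ∪ Finset.univ.image f, ?_, ?_⟩
  · intro a ha b hb hab
    simp only [Finset.coe_union, Finset.coe_image, Finset.coe_univ, Set.image_univ,
      Set.mem_union, Set.mem_range] at ha hb
    rcases ha with ⟨i, rfl⟩ | ⟨i, rfl⟩ <;> rcases hb with ⟨j, rfl⟩ | ⟨j, rfl⟩
    · exact orderedCliques_adj hg (fun h => hab (by rw [h]))
    · exact hHG (hgf i j)
    · exact (hHG (hgf j i)).symm
    · exact orderedCliques_adj hf (fun h => hab (by rw [h]))
  · have hinj : Function.Injective (Prod.map g f) :=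
      (orderedCliques_injective hg).prodMap (orderedCliques_injective hf)
    have : (Finset.univ.image (Prod.map g f)).card = s ^ 2 := by
      rw [Finset.card_image_of_injective _ hinj]
      simp [sq]
    rw [← this]
    refine Finset.card_le_card ?_
    intro x hx
    obtain ⟨⟨i, j⟩, -, rfl⟩ := Finset.mem_image.1 hx
    simp [mem_adjPairs, hgf i j]

/-! ### Greedy covering, and covering by small cliques -/

open Classical in
/-- If every subgraph `H` of `G` with at least `T` adjacent pairs has a `β √|H|` share in some
clique of `G`, then a greedy choice of cliques covers the edges efficiently. -/
theorem exists_cover_of_greedy (G : SimpleGraph V) {β T : ℝ} (hβ : 0 < β) (hT : 0 < T)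
    (hgr : ∀ H : SimpleGraph V, H ≤ G → T ≤ (H.adjPairs.card : ℝ) →
      ∃ K : Finset V, G.IsClique (K : Set V) ∧ β * Real.sqrt (H.adjPairs.card) ≤
        ((H.adjPairs.filter fun x => x.1 ∈ K ∧ x.2 ∈ K).card : ℝ))
    (H : SimpleGraph V) (hH : H ≤ G) :
    ∃ F : Finset (Finset V), (∀ K ∈ F, G.IsClique (K : Set V)) ∧
      (∀ u v, H.Adj u v → ∃ K ∈ F, u ∈ K ∧ v ∈ K) ∧
      (F.card : ℝ) ≤ T + 2 / β * Real.sqrt (H.adjPairs.card) := by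
  induction hk : H.adjPairs.card using Nat.strong_induction_on generalizing H with
  | _ k ih =>
  rcases lt_or_ge (k : ℝ) T with hkT | hkT
  · refine ⟨H.adjPairs.image fun x => {x.1, x.2}, ?_, ?_, ?_⟩
    · intro K hK
      obtain ⟨x, hx, rfl⟩ := Finset.mem_image.1 hK
      have := hH (mem_adjPairs.1 hx)
      simp [this]
    · intro u v huv
      exact ⟨{u, v}, Finset.mem_image.2 ⟨(u, v), mem_adjPairs.2 huv, rfl⟩, by simp, by simp⟩
    · have h1 : ((H.adjPairs.image fun x => ({x.1, x.2} : Finset V)).card : ℝ) ≤ k := by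
        rw [← hk]; exact_mod_cast Finset.card_image_le
      have : 0 ≤ 2 / β * Real.sqrt k := by positivity
      linarith
  · obtain ⟨K, hK, hKc⟩ := hgr H hH (by rw [hk]; exact hkT)
    rw [hk] at hKc
    have hkpos : (0 : ℝ) < k := hT.trans_le hkT
    have hsq : 0 < Real.sqrt k := Real.sqrt_pos.2 hkpos
    let H' : SimpleGraph V :=
      { Adj := fun u v => H.Adj u v ∧ ¬ (u ∈ K ∧ v ∈ K)
        symm := ⟨fun u v h => ⟨h.1.symm, fun h' => h.2 ⟨h'.2, h'.1⟩⟩⟩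
        loopless := ⟨fun u h => H.irrefl h.1⟩ }
    have hcard : (H.adjPairs.filter fun x => x.1 ∈ K ∧ x.2 ∈ K).card + H'.adjPairs.card = k := by
      rw [← hk, ← Finset.card_filter_add_card_filter_not (s := H.adjPairs)
        (fun x => x.1 ∈ K ∧ x.2 ∈ K)]
      congr 2
      ext x
      simp [mem_adjPairs, H']
    have hcardR : ((H.adjPairs.filter fun x => x.1 ∈ K ∧ x.2 ∈ K).card : ℝ) + H'.adjPairs.card
        = k := by exact_mod_cast hcard
    have hpos : 0 < β * Real.sqrt k := by positivity
    have hlt : H'.adjPairs.card < k := by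
      have : (H'.adjPairs.card : ℝ) < k := by linarith
      exact_mod_cast this
    obtain ⟨F, hF1, hF2, hF3⟩ := ih _ hlt H' (fun u v h => hH h.1) rfl
    refine ⟨insert K F, ?_, ?_, ?_⟩
    · intro K' hK'
      rcases Finset.mem_insert.1 hK' with rfl | h
      · exact hK
      · exact hF1 _ h
    · intro u v huv
      by_cases h : u ∈ K ∧ v ∈ K
      · exact ⟨K, Finset.mem_insert_self _ _, h⟩
      · obtain ⟨K', hK', h'⟩ := hF2 u v ⟨huv, h⟩
        exact ⟨K', Finset.mem_insert_of_mem hK', h'⟩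
    · have h1 : ((insert K F).card : ℝ) ≤ F.card + 1 := by
        exact_mod_cast Finset.card_insert_le _ _
      -- With a, b the square roots before and after, βa ≤ a² - b² ≤ 2a(a - b), so the root drops by
      -- at least β/2, which pays for the one new clique.
      have h2 : 1 + 2 / β * Real.sqrt (H'.adjPairs.card) ≤ 2 / β * Real.sqrt k := by
        have ha := Real.sq_sqrt hkpos.le
        have hb := Real.sq_sqrt (Nat.cast_nonneg (α := ℝ) H'.adjPairs.card)
        have hb0 := Real.sqrt_nonneg (H'.adjPairs.card : ℝ)
        have hle : Real.sqrt (H'.adjPairs.card) ≤ Real.sqrt k :=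
          Real.sqrt_le_sqrt (by exact_mod_cast hlt.le)
        set a := Real.sqrt k
        set b := Real.sqrt (H'.adjPairs.card : ℝ)
        have h3 : β * a ≤ (a - b) * (2 * a) := by nlinarith
        have h4 : β ≤ 2 * (a - b) := by
          by_contra! hc
          nlinarith
        have h5 : 1 ≤ 2 / β * (a - b) := by
          rw [div_mul_eq_mul_div, le_div_iff₀ hβ]; linarith
        linarith
      linarith

/-- A graph whose cliques have at most `k` vertices needs many cliques in a cover. -/
theorem adjPairs_card_le_of_isCliqueCover {G : SimpleGraph V} {k : ℕ}
    (hk : ∀ K : Finset V, G.IsClique (K : Set V) → K.card ≤ k) {F : Finset (Finset V)}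
    (hF : G.IsCliqueCover F) : G.adjPairs.card ≤ F.card * k ^ 2 := by
  classical
  have hsub : G.adjPairs ⊆ F.biUnion fun K => K ×ˢ K := by
    intro x hx
    obtain ⟨K, hK, h1, h2⟩ := hF.2 _ _ (mem_adjPairs.1 hx)
    exact Finset.mem_biUnion.2 ⟨K, hK, Finset.mem_product.2 ⟨h1, h2⟩⟩
  refine (Finset.card_le_card hsub).trans (Finset.card_biUnion_le_card_mul _ _ _ ?_)
  intro K hK
  rw [Finset.card_product, sq]
  exact Nat.mul_le_mul (hk K (hF.1 K hK)) (hk K (hF.1 K hK))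

/-- Any k vertices of a larger clique can be enumerated, so a first moment bound at the single
length k controls all clique sizes. -/
theorem card_lt_of_orderedCliques_eq_empty {G : SimpleGraph V} {k : ℕ}
    (h : G.orderedCliques k Finset.univ = ∅) (K : Finset V) (hK : G.IsClique (K : Set V)) :
    K.card < k := by
  by_contra! hc
  obtain ⟨K', hK', hcard⟩ := Finset.exists_subset_card_eq hc
  have e := (Finset.equivFinOfCardEq hcard).symm
  have : (fun i => (e i : V)) ∈ G.orderedCliques k Finset.univ := by
    refine mem_orderedCliques.2 ⟨fun i => Finset.mem_univ _, fun i j hij => ?_⟩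
    exact hK (hK' (e i).2) (hK' (e j).2) fun h' =>
      hij.ne (e.injective (Subtype.ext h'))
  rw [h] at this
  simp at this

end Combinatorics

end SimpleGraph

namespace SimpleGraph

/-! ### First moments and lower tails in the binomial random graph -/

section Probability

open MeasureTheory

variable {V : Type*} [Fintype V]

/-- With measurable singletons, probabilities on this finite space become sums of point masses. -/
instance instMeasurableSingletonClassOfFintype : MeasurableSingletonClass (SimpleGraph V) where
  measurableSet_singleton G := by
    convert measurable_edgeSet (V := V) (measurableSet_singleton G.edgeSet)
    ext H
    simp

open Classical in
/-- Markov's inequality for the finite probability space of graphs on `V`. -/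
theorem mul_binomialRandom_real_le (p : unitInterval) (A : Set (SimpleGraph V))
    (f : SimpleGraph V → ℝ) (t : ℝ) (hf : ∀ G, 0 ≤ f G) (hA : ∀ G ∈ A, t ≤ f G) :
    t * (binomialRandom V p).real A ≤ ∑ G, (binomialRandom V p).real {G} * f G := by
  classical
  have h : (binomialRandom V p).real A
      = ∑ G ∈ Finset.univ.filter (· ∈ A), (binomialRandom V p).real {G} := by
    rw [sum_measureReal_singleton]
    simp
  rw [h, Finset.mul_sum]
  refine (Finset.sum_le_sum (g := fun G => (binomialRandom V p).real {G} * f G) ?_).trans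
    (Finset.sum_le_sum_of_subset_of_nonneg (Finset.subset_univ _)
      fun G _ _ => mul_nonneg measureReal_nonneg (hf G))
  intro G hG
  rw [mul_comm]
  exact mul_le_mul_of_nonneg_left (hA G (Finset.mem_filter.1 hG).2) measureReal_nonneg

open Classical in
/-- The generating function of the edge set of the binomial random graph. -/
theorem sum_binomialRandom_real_mul_prod (p : unitInterval) (a b : Sym2 V → ℝ) :
    ∑ G : SimpleGraph V, (binomialRandom V p).real {G} *
        ∏ e ∈ Finset.univ.filter (fun e : Sym2 V => ¬ e.IsDiag),
          (if e ∈ G.edgeSet then a e else b e)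
      = ∏ e ∈ Finset.univ.filter (fun e : Sym2 V => ¬ e.IsDiag),
          ((p : ℝ) * a e + (1 - p) * b e) := by
  set M := Finset.univ.filter (fun e : Sym2 V => ¬ e.IsDiag) with hM
  have hMcard : M.card = (Fintype.card V).choose 2 := by
    rw [← Sym2.card_diagSet_compl, ← Set.toFinset_card]
    congr 1
    ext e
    simp [hM]
  have hsub : ∀ G : SimpleGraph V, G.edgeFinset ⊆ M := by
    intro G e he
    simp only [hM, Finset.mem_filter, Finset.mem_univ, true_and]
    exact G.not_isDiag_of_mem_edgeFinset he
  -- Expanding the product gives one term for each set of non-loop pairs, that is, for each graph.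
  rw [Finset.prod_add]
  refine Finset.sum_bij' (fun G _ => G.edgeFinset) (fun t _ => fromEdgeSet (t : Set (Sym2 V)))
    ?_ ?_ ?_ ?_ ?_
  · intro G _
    exact Finset.mem_powerset.2 (hsub G)
  · intro t _
    exact Finset.mem_univ _
  · intro G _
    simp
  · intro t ht
    rw [Finset.mem_powerset] at ht
    ext e
    simp only [mem_edgeFinset, edgeSet_fromEdgeSet, Set.mem_sdiff, Finset.mem_coe]
    refine ⟨fun h => h.1, fun h => ⟨h, ?_⟩⟩
    have := ht h
    simpa [hM] using this
  · intro G _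
    have h1 : (binomialRandom V p).real {G}
        = (p : ℝ) ^ G.edgeFinset.card * (1 - p : ℝ) ^ (M \ G.edgeFinset).card := by
      rw [measureReal_def, binomialRandom_singleton, Finset.card_sdiff_of_subset (hsub G), hMcard,
        ← coe_edgeFinset, Set.ncard_coe_finset, Nat.card_eq_fintype_card]
      simp
    have h2 : M.filter (fun e => e ∈ G.edgeSet) = G.edgeFinset := by
      ext e
      simp only [Finset.mem_filter, mem_edgeFinset]
      exact ⟨fun h => h.2, fun h => ⟨hsub G (mem_edgeFinset.2 h), h⟩⟩
    have h3 : M.filter (fun e => ¬ e ∈ G.edgeSet) = M \ G.edgeFinset := by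
      ext e
      simp
    rw [h1, Finset.prod_ite, h2, h3, Finset.prod_mul_distrib, Finset.prod_mul_distrib,
      Finset.prod_const, Finset.prod_const]
    ring

open Classical in
/-- The edges of the complete graph on `U`. -/
noncomputable def edgesOn (U : Finset V) : Finset (Sym2 V) :=
  U.offDiag.image (Function.uncurry Sym2.mk)

omit [Fintype V] in
theorem card_edgesOn (U : Finset V) : (edgesOn U).card = U.card.choose 2 := by
  classical
  rw [← Sym2.card_image_offDiag]
  unfold edgesOn
  congr!

omit [Fintype V] in
theorem mk_mem_edgesOn {U : Finset V} {u v : V} :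
    s(u, v) ∈ edgesOn U ↔ u ∈ U ∧ v ∈ U ∧ u ≠ v := by
  classical
  simp only [edgesOn, Finset.mem_image, Finset.mem_offDiag, Prod.exists, Function.uncurry_apply_pair]
  constructor
  · rintro ⟨a, b, ⟨ha, hb, hab⟩, h⟩
    rcases Sym2.eq_iff.1 h with ⟨rfl, rfl⟩ | ⟨rfl, rfl⟩
    · exact ⟨ha, hb, hab⟩
    · exact ⟨hb, ha, hab.symm⟩
  · intro h
    exact ⟨u, v, h, rfl⟩

omit [Fintype V] in
theorem not_isDiag_of_mem_edgesOn {U : Finset V} {e : Sym2 V} (he : e ∈ edgesOn U) :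
    ¬ e.IsDiag := by
  induction e with
  | _ u v =>
    simpa using (mk_mem_edgesOn.1 he).2.2

open Classical in
/-- The generating function of the edges of the binomial random graph inside a vertex set. -/
theorem sum_binomialRandom_real_mul_prod_edgesOn (p : unitInterval) (U : Finset V) (a b : ℝ) :
    (∑ G : SimpleGraph V, (binomialRandom V p).real {G} *
        ∏ e ∈ edgesOn U, (if e ∈ G.edgeSet then a else b))
      = ((p : ℝ) * a + (1 - p) * b) ^ (U.card.choose 2) := by
  classical
  -- Pairs outside U get weight 1 and contribute the factor p + (1 - p) = 1.
  have h := sum_binomialRandom_real_mul_prod p (fun e : Sym2 V => if e ∈ edgesOn U then a else 1)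
    (fun e => if e ∈ edgesOn U then b else 1)
  have hf : (Finset.univ.filter (fun e : Sym2 V => ¬ e.IsDiag)).filter (· ∈ edgesOn U)
      = edgesOn U := by
    ext e
    simp only [Finset.mem_filter, Finset.mem_univ, true_and]
    exact ⟨fun h => h.2, fun h => ⟨not_isDiag_of_mem_edgesOn h, h⟩⟩
  have hl : ∀ G : SimpleGraph V, ∏ e ∈ edgesOn U, (if e ∈ G.edgeSet then a else b)
      = ∏ e ∈ Finset.univ.filter (fun e : Sym2 V => ¬ e.IsDiag),
          (if e ∈ G.edgeSet then (if e ∈ edgesOn U then a else 1)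
            else (if e ∈ edgesOn U then b else 1)) := by
    intro G
    rw [← hf, Finset.prod_filter, hf]
    refine Finset.prod_congr rfl fun e _ => ?_
    split_ifs <;> rfl
  have hr : ∏ e ∈ Finset.univ.filter (fun e : Sym2 V => ¬ e.IsDiag),
      ((p : ℝ) * (if e ∈ edgesOn U then a else 1) + (1 - p) * (if e ∈ edgesOn U then b else 1))
      = ((p : ℝ) * a + (1 - p) * b) ^ (U.card.choose 2) := by
    rw [← card_edgesOn U, ← Finset.prod_const]
    conv_rhs => rw [← hf, Finset.prod_filter]
    refine Finset.prod_congr rfl fun e _ => ?_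
    split_ifs
    · rfl
    · ring
  rw [← hr, ← h]
  refine Finset.sum_congr rfl fun G _ => ?_
  rw [hl G]

open Classical in
/-- The expected number of ordered cliques. -/
theorem sum_binomialRandom_real_mul_card_orderedCliques_le (p : unitInterval) (s : ℕ) :
    ∑ G : SimpleGraph V, (binomialRandom V p).real {G} *
        ((G.orderedCliques s Finset.univ).card : ℝ)
      ≤ (Fintype.card V : ℝ) ^ s * (p : ℝ) ^ (s.choose 2) := by
  classical
  have h1 : ∀ G : SimpleGraph V, ((G.orderedCliques s Finset.univ).card : ℝ)
      = ∑ f : Fin s → V, if f ∈ G.orderedCliques s Finset.univ then 1 else 0 := by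
    intro G
    rw [Finset.sum_boole]
    simp
  simp_rw [h1, Finset.mul_sum]
  rw [Finset.sum_comm]
  have h2 : ∀ f : Fin s → V, ∑ G : SimpleGraph V, (binomialRandom V p).real {G} *
      (if f ∈ G.orderedCliques s Finset.univ then (1 : ℝ) else 0) ≤ (p : ℝ) ^ (s.choose 2) := by
    intro f
    by_cases hf : Function.Injective f
    · have h := sum_binomialRandom_real_mul_prod_edgesOn p (Finset.univ.image f) 1 0
      rw [Finset.card_image_of_injective _ hf, Finset.card_univ, Fintype.card_fin, mul_one,
        mul_zero, add_zero] at h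
      rw [← h]
      refine Finset.sum_le_sum fun G _ => mul_le_mul_of_nonneg_left ?_ measureReal_nonneg
      split_ifs with hG
      · refine le_of_eq (Finset.prod_eq_one fun e he => ?_).symm
        rw [if_pos]
        induction e with
        | _ u v =>
          obtain ⟨hu, hv, huv⟩ := mk_mem_edgesOn.1 he
          obtain ⟨i, -, rfl⟩ := Finset.mem_image.1 hu
          obtain ⟨j, -, rfl⟩ := Finset.mem_image.1 hv
          exact orderedCliques_adj hG fun h => huv (by rw [h])
      · exact Finset.prod_nonneg fun e _ => by split_ifs <;> norm_num
    · have : ∀ G : SimpleGraph V, f ∉ G.orderedCliques s Finset.univ :=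
        fun G hG => hf (orderedCliques_injective hG)
      simp only [this, if_false, mul_zero, Finset.sum_const_zero]
      have := p.2.1
      positivity
  refine (Finset.sum_le_sum fun f _ => h2 f).trans (le_of_eq ?_)
  simp

-- The handshake identity for the graph keeping all vertices but only the edges inside U.
open Classical in
theorem two_mul_card_edgesOn_filter (G : SimpleGraph V) (U : Finset V) :
    2 * ((edgesOn U).filter (· ∈ G.edgeSet)).card = ∑ v ∈ U, (G.neighborsIn U v).card := by
  let G' : SimpleGraph V :=
    { Adj := fun u v => G.Adj u v ∧ u ∈ U ∧ v ∈ U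
      symm := ⟨fun u v h => ⟨h.1.symm, h.2.2, h.2.1⟩⟩
      loopless := ⟨fun u h => G.irrefl h.1⟩ }
  have h := G'.sum_degrees_eq_twice_card_edges
  have h1 : G'.edgeFinset = (edgesOn U).filter (· ∈ G.edgeSet) := by
    ext e
    induction e with
    | _ u v =>
      simp only [mem_edgeFinset, mem_edgeSet, Finset.mem_filter, mk_mem_edgesOn, G']
      exact ⟨fun h => ⟨⟨h.2.1, h.2.2, h.1.ne⟩, h.1⟩, fun h => ⟨h.2, h.1.1, h.1.2.1⟩⟩
  rw [← h1, ← h]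
  rw [← Finset.sum_subset (Finset.subset_univ U)]
  · refine Finset.sum_congr rfl fun v hv => ?_
    rw [← card_neighborFinset_eq_degree]
    congr 1
    ext w
    simp [mem_neighborsIn, G', hv, and_comm]
  · intro v _ hv
    rw [← card_neighborFinset_eq_degree, Finset.card_eq_zero]
    ext w
    simp [G', hv]

/-- A lower tail estimate for the number of edges inside a vertex set. -/
theorem binomialRandom_real_lower_tail (p : unitInterval) (U : Finset V) {ε : ℝ} (hε : 0 < ε)
    (hε1 : ε ≤ 1) (hU : 2 ≤ ε * U.card) :
    (binomialRandom V p).real {G | ∑ v ∈ U, ((G.neighborsIn U v).card : ℝ)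
        < p * (1 - ε) * (U.card : ℝ) ^ 2} ≤ Real.exp (- (p * ε ^ 2 * (U.card : ℝ) ^ 2 / 64)) := by
  classical
  have hp0 := p.2.1
  have hp1 := p.2.2
  set u : ℝ := (U.card : ℝ) with hu
  set N := U.card.choose 2 with hN
  have hu2 : 2 ≤ u := by nlinarith
  have hNu : (N : ℝ) = u * (u - 1) / 2 := by rw [hN, Nat.cast_choose_two]
  -- The exponential moment bound has exponent pN(l² - lε/2), minimised at l = ε/4 with value
  -- -pNε²/16; then N ≥ u²/4 gives the constant 64.
  set l : ℝ := ε / 4 with hl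
  have hl0 : 0 < l := by positivity
  have hmarkov := mul_binomialRandom_real_le p {G | ∑ v ∈ U, ((G.neighborsIn U v).card : ℝ)
        < p * (1 - ε) * u ^ 2}
    (fun G => ∏ e ∈ edgesOn U, (if e ∈ G.edgeSet then Real.exp (-l) else 1))
    (Real.exp (-(l * (p * (1 - ε / 2) * N))))
    (fun G => Finset.prod_nonneg fun e _ => by split_ifs <;> positivity) (by
      intro G hG
      rw [Set.mem_ofPred_eq, ← Nat.cast_sum, ← two_mul_card_edgesOn_filter] at hG
      rw [Finset.prod_ite, Finset.prod_const, Finset.prod_const_one, mul_one, ← Real.exp_nat_mul]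
      refine Real.exp_le_exp.2 ?_
      push_cast at hG
      set c : ℝ := (((edgesOn U).filter (· ∈ G.edgeSet)).card : ℝ)
      -- Half of ε is spent on replacing u² by u(u - 1); this is where εu ≥ 2 enters.
      have h1 : (1 - ε) * u ≤ (1 - ε / 2) * (u - 1) := by nlinarith
      have h2 : p * (1 - ε) * u ^ 2 ≤ 2 * (p * (1 - ε / 2) * N) := by
        rw [hNu]
        have := mul_le_mul_of_nonneg_left h1 (mul_nonneg hp0 (by linarith : 0 ≤ u))
        nlinarith
      have h3 : c ≤ p * (1 - ε / 2) * N := by linarith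
      have := mul_le_mul_of_nonneg_left h3 hl0.le
      linarith)
  rw [sum_binomialRandom_real_mul_prod_edgesOn] at hmarkov
  have hexp : Real.exp (-l) ≤ 1 - l + l ^ 2 := by
    have h1 : l + 1 ≤ Real.exp l := Real.add_one_le_exp l
    rw [Real.exp_neg, inv_le_comm₀ (Real.exp_pos _) (by nlinarith)]
    refine le_trans ?_ h1
    rw [inv_le_iff_one_le_mul₀ (by nlinarith)]
    nlinarith [pow_pos hl0 3]
  have hbase : (p : ℝ) * Real.exp (-l) + (1 - p) * 1 ≤ Real.exp (-(p * (l - l ^ 2))) := by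
    refine le_trans ?_ (Real.add_one_le_exp _)
    nlinarith
  have hpow : ((p : ℝ) * Real.exp (-l) + (1 - p) * 1) ^ N ≤ Real.exp (N * -(p * (l - l ^ 2))) := by
    rw [Real.exp_nat_mul]
    refine pow_le_pow_left₀ ?_ hbase _
    have := Real.exp_pos (-l)
    nlinarith [mul_nonneg hp0 this.le]
  have h4 := hmarkov.trans hpow
  rw [← le_div_iff₀' (Real.exp_pos _), ← Real.exp_sub] at h4
  refine h4.trans (Real.exp_le_exp.2 ?_)
  have h5 : (N : ℝ) * -(p * (l - l ^ 2)) - -(l * (p * (1 - ε / 2) * N))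
      = - (p * ε ^ 2 * N / 16) := by rw [hl]; ring
  rw [h5, hNu]
  have h6 : 0 ≤ p * ε ^ 2 := by positivity
  have h7 : u ^ 2 ≤ 2 * (u * (u - 1)) := by nlinarith
  nlinarith

end Probability

end SimpleGraph

namespace SimpleGraph

/-! ### Deterministic bounds from the pseudo-random properties -/

section Deterministic

theorem card_adjPairs_le {n : ℕ} (H : SimpleGraph (Fin n)) :
    (H.adjPairs.card : ℝ) ≤ (n : ℝ) ^ 2 := by
  have h := Finset.card_le_univ H.adjPairs
  rw [Fintype.card_prod, Fintype.card_fin, ← sq] at h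
  exact_mod_cast h

open Classical in
/-- In a graph with pseudo-random clique counts, every subgraph that is not too sparse has many
edges in some clique. -/
theorem exists_clique_of_clique_counts {n : ℕ} (hn : 0 < n) {G H : SimpleGraph (Fin n)}
    {p c L : ℝ} (hp0 : 0 < p) (hp1 : p ≤ 1) (hL : Real.exp L = n) (hL1 : 1 ≤ L) (hc0 : 0 < c)
    (hc1 : c ≤ 1 / 100) (hcp : c * Real.log (2 / p) ≤ 1 / 100) (hcL : 1 ≤ c ^ 2 * L)
    (hexp : 2 * L ^ 2 * Real.exp (0.65 * L) < Real.exp (0.95 * L))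
    (hdens : ∀ U : Finset (Fin n), Real.exp (0.6 * L) ≤ U.card →
      p * (1 - 1 / (2 * L ^ 2)) * (U.card : ℝ) ^ 2 ≤ ∑ v ∈ U, ((G.neighborsIn U v).card : ℝ))
    (hcount : ∀ s : ℕ, (s : ℝ) ≤ L → ((G.orderedCliques s Finset.univ).card : ℝ)
      ≤ L ^ 2 * ((n : ℝ) ^ s * p ^ (s.choose 2)))
    (hHG : H ≤ G) (hT : (n : ℝ) ^ 2 / L ^ 2 ≤ (H.adjPairs.card : ℝ)) :
    ∃ K : Finset (Fin n), G.IsClique (K : Set (Fin n)) ∧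
      c ^ 2 * L ^ 2 / (4 * n) * Real.sqrt (H.adjPairs.card) ≤
        ((H.adjPairs.filter fun x => x.1 ∈ K ∧ x.2 ∈ K).card : ℝ) := by
  have hn' : (0 : ℝ) < n := by exact_mod_cast hn
  have hL0 : 0 < L := by linarith
  set ε : ℝ := 1 / (2 * L ^ 2) with hε
  have hεL : L ^ 2 * ε = 1 / 2 := by rw [hε]; field_simp
  have hε0 : 0 < ε := by positivity
  have hε1 : ε ≤ 1 / 2 := by nlinarith [mul_le_mul_of_nonneg_right (one_le_pow₀ hL1 : 1 ≤ L ^ 2) hε0.le]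
  clear_value ε
  set q := p * (1 - ε) with hq
  have hq0 : 0 < q := mul_pos hp0 (by linarith)
  have hqp : p / 2 ≤ q := by rw [hq]; nlinarith
  have hq1 : q ≤ 1 := by rw [hq]; nlinarith
  clear_value q
  set δ : ℝ := (H.adjPairs.card : ℝ) / (n : ℝ) ^ 2 with hδ
  have hD : (H.adjPairs.card : ℝ) = δ * (n : ℝ) ^ 2 := by rw [hδ]; field_simp
  have hδ1 : δ ≤ 1 := div_le_one_of_le₀ (card_adjPairs_le H) (by positivity)
  have hδL : 1 / L ^ 2 ≤ δ := by
    rw [hδ, le_div_iff₀ (by positivity)]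
    calc 1 / L ^ 2 * (n : ℝ) ^ 2 = (n : ℝ) ^ 2 / L ^ 2 := by ring
      _ ≤ _ := hT
  have hδ0 : 0 < δ := lt_of_lt_of_le (by positivity) hδL
  -- Here y = δ^(1/2) and x = δ^(1/4). With s of order Lx, s² is proportional to √δ, the gain that
  -- the greedy argument needs, while s log(1/δ) stays a small multiple of L.
  set y := Real.sqrt δ with hy
  set x := Real.sqrt y with hx
  have hy0 : 0 < y := Real.sqrt_pos.2 hδ0
  have hx0 : 0 < x := Real.sqrt_pos.2 hy0
  have hyδ : y ^ 2 = δ := Real.sq_sqrt hδ0.le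
  have hxy : x ^ 2 = y := Real.sq_sqrt hy0.le
  clear_value x y δ
  have hy1 : y ≤ 1 := by rw [← sq_le_one_iff₀ hy0.le, hyδ]; exact hδ1
  have hx1 : x ≤ 1 := by rw [← sq_le_one_iff₀ hx0.le, hxy]; exact hy1
  have hyL : 1 ≤ y * L := by
    rw [← one_le_sq_iff₀ (mul_pos hy0 hL0).le, mul_pow, hyδ]
    rwa [div_le_iff₀ (pow_pos hL0 2)] at hδL
  -- Being at least 1, the quantity loses at most a factor 2 when rounded down to s.
  have hcLx : 1 ≤ c * L * x := by
    rw [← one_le_sq_iff₀ (mul_pos (mul_pos hc0 hL0) hx0).le]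
    calc (1 : ℝ) ≤ (c ^ 2 * L) * (y * L) := one_le_mul_of_one_le_of_one_le hcL hyL
      _ = (c * L * x) ^ 2 := by rw [mul_pow, hxy]; ring
  set s := ⌊c * L * x⌋₊ with hs
  have hs1 : (s : ℝ) ≤ c * L * x := Nat.floor_le (by linarith)
  have hs2 : c * L * x / 2 ≤ s := by
    have h1 := Nat.lt_floor_add_one (c * L * x)
    have h2 : (1 : ℝ) ≤ s := by
      have : 1 ≤ s := Nat.le_floor (by simpa using hcLx)
      exact_mod_cast this
    rw [← hs] at h1
    linarith
  clear_value s
  have hscL : (s : ℝ) ≤ c * L := hs1.trans (mul_le_of_le_one_right (mul_pos hc0 hL0).le hx1)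
  have hsL : (s : ℝ) ≤ L := hscL.trans (mul_le_of_le_one_left hL0.le (by linarith))
  -- The final threshold is still at most n^0.65, because q^(-s) ≤ n^0.01.
  have hM : Real.exp (0.6 * L) / q ^ s ≤ Real.exp (0.65 * L) := by
    have h1 : 1 / q ^ s ≤ Real.exp (L / 100) := by
      calc 1 / q ^ s ≤ 1 / (p / 2) ^ s := by gcongr
        _ = (2 / p) ^ s := by rw [one_div, ← inv_pow, inv_div]
        _ = Real.exp (s * Real.log (2 / p)) := by
          rw [Real.exp_nat_mul, Real.exp_log (by positivity)]
        _ ≤ Real.exp (L / 100) := by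
          refine Real.exp_le_exp.2 ?_
          have h0 : 0 ≤ Real.log (2 / p) :=
            Real.log_nonneg (by rw [le_div_iff₀ hp0]; linarith)
          calc (s : ℝ) * Real.log (2 / p) ≤ c * L * Real.log (2 / p) := by gcongr
            _ = (c * Real.log (2 / p)) * L := by ring
            _ ≤ 1 / 100 * L := by gcongr
            _ = L / 100 := by ring
    calc Real.exp (0.6 * L) / q ^ s = Real.exp (0.6 * L) * (1 / q ^ s) := by ring
      _ ≤ Real.exp (0.6 * L) * Real.exp (L / 100) := by gcongr
      _ = Real.exp (0.6 * L + L / 100) := (Real.exp_add _ _).symm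
      _ ≤ Real.exp (0.65 * L) := Real.exp_le_exp.2 (by linarith)
  have hδs : Real.exp (-(0.05 * L)) ≤ (δ / 2) ^ s := by
    have h1 : (δ / 2) ^ s = Real.exp (-(s * Real.log (2 / δ))) := by
      rw [← mul_neg, ← Real.log_inv, inv_div, Real.exp_nat_mul, Real.exp_log (by positivity)]
    rw [h1]
    refine Real.exp_le_exp.2 (neg_le_neg ?_)
    have h2 : Real.log (2 / δ) ≤ 5 / x := by
      have h3 : Real.log (2 / δ) = Real.log 2 + 4 * Real.log (1 / x) := by
        rw [← hyδ, ← hxy, Real.log_div (by norm_num) (by positivity), one_div, Real.log_inv,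
          ← pow_mul, Real.log_pow]
        push_cast
        ring
      have h4 : Real.log (1 / x) ≤ 1 / x - 1 := Real.log_le_sub_one_of_pos (by positivity)
      have h5 : Real.log 2 ≤ 2 - 1 := Real.log_le_sub_one_of_pos (by norm_num)
      have h6 : 5 / x = 1 / x + 4 * (1 / x) := by ring
      have h7 : 1 ≤ 1 / x := by rw [le_div_iff₀ hx0]; linarith
      rw [h3, h6]
      linarith
    calc (s : ℝ) * Real.log (2 / δ) ≤ s * (5 / x) := by gcongr
      _ ≤ c * L * x * (5 / x) := by gcongr
      _ = 5 * c * L := by field_simp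
      _ ≤ 0.05 * L := by linarith [mul_le_mul_of_nonneg_right hc1 hL0.le]
  have hnδs : Real.exp (0.95 * L) ≤ n * (δ / 2) ^ s := by
    calc Real.exp (0.95 * L) = Real.exp L * Real.exp (-(0.05 * L)) := by
          rw [← Real.exp_add]; ring_nf
      _ ≤ n * (δ / 2) ^ s := by rw [hL]; gcongr
  -- The threshold is at most half the average H-degree δn, so subtracting it costs at most a factor
  -- 2 in the base.
  have hMδ : Real.exp (0.6 * L) / q ^ s ≤ δ * n / 2 := by
    have h1 : Real.exp (0.95 * L) ≤ n := by rw [← hL]; exact Real.exp_le_exp.2 (by linarith)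
    have h2 : 1 / L ^ 2 * n ≤ δ * n := by gcongr
    have h3 : 2 * Real.exp (0.65 * L) ≤ 1 / L ^ 2 * n := by
      rw [one_div, inv_mul_eq_div, le_div_iff₀ (by positivity)]
      linarith
    linarith
  -- This dictates ε = 1/(2L²): by Bernoulli the density loss over at most L² factors is at most 1/2
  -- in total.
  have hqC : p ^ (s.choose 2) / 2 ≤ q ^ (s.choose 2) := by
    rw [hq, mul_pow]
    have h1 : (1 : ℝ) + (s.choose 2 : ℕ) * (-ε) ≤ (1 + -ε) ^ (s.choose 2) :=
      one_add_mul_le_pow (by linarith) _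
    have h2 : ((s.choose 2 : ℕ) : ℝ) ≤ L ^ 2 := by
      rw [Nat.cast_choose_two]
      have h0 : (0 : ℝ) ≤ s := Nat.cast_nonneg s
      linarith [mul_self_le_mul_self h0 hsL, sq_nonneg L]
    have h3 : (1 : ℝ) / 2 ≤ (1 - ε) ^ (s.choose 2) := by
      rw [sub_eq_add_neg]
      refine le_trans ?_ h1
      linarith [mul_le_mul_of_nonneg_right h2 hε0.le]
    calc p ^ (s.choose 2) / 2 = p ^ (s.choose 2) * (1 / 2) := by ring
      _ ≤ _ := by gcongr
  have hDn : (H.adjPairs.card : ℝ) / Fintype.card (Fin n) = δ * n := by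
    rw [hD, Fintype.card_fin]; field_simp
  obtain ⟨K, hK, hKs⟩ := exists_clique_adjPairs (s := s) hHG hq0 hq1
    (Real.exp_pos (0.6 * L)).le hdens (hcount s hsL)
    (by rw [hDn]; have : 0 < δ * n := by positivity
        linarith) (by
      rw [hDn, Fintype.card_fin]
      -- After cancelling n^s p^(s choose 2)/2, the comparison is 2L² n^0.65 < n^0.95.
      calc Real.exp (0.6 * L) / q ^ s * (L ^ 2 * ((n : ℝ) ^ s * p ^ (s.choose 2)))
          ≤ Real.exp (0.65 * L) * (L ^ 2 * ((n : ℝ) ^ s * p ^ (s.choose 2))) := by gcongr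
        _ = (2 * L ^ 2 * Real.exp (0.65 * L)) * ((n : ℝ) ^ s * p ^ (s.choose 2) / 2) := by ring
        _ < Real.exp (0.95 * L) * ((n : ℝ) ^ s * p ^ (s.choose 2) / 2) := by gcongr
        _ ≤ (n * (δ / 2) ^ s) * ((n : ℝ) ^ s * p ^ (s.choose 2) / 2) := by gcongr
        _ = p ^ (s.choose 2) / 2 * (n * (δ * n / 2) ^ s) := by
          rw [show δ * n / 2 = δ / 2 * n by ring, mul_pow]; ring
        _ ≤ q ^ (s.choose 2) * (n * (δ * n - Real.exp (0.6 * L) / q ^ s) ^ s) := by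
          gcongr
          linarith)
  refine ⟨K, hK, ?_⟩
  have h1 : ((s ^ 2 : ℕ) : ℝ) ≤
      ((H.adjPairs.filter fun x => x.1 ∈ K ∧ x.2 ∈ K).card : ℝ) := by
    rw [Nat.cast_le]
    convert hKs
  refine le_trans ?_ h1
  have h2 : Real.sqrt (H.adjPairs.card) = y * n := by
    rw [hD, Real.sqrt_mul hδ0.le, Real.sqrt_sq hn'.le, hy]
  rw [h2]
  push_cast
  calc c ^ 2 * L ^ 2 / (4 * n) * (y * n) = (c * L * x / 2) ^ 2 := by
        rw [← hxy]; field_simp; norm_num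
    _ ≤ (s : ℝ) ^ 2 := by gcongr

/-- Upper bound for the clique cover number of a graph with pseudo-random clique counts. -/
theorem cliqueCoverNumber_le_of_clique_counts {n : ℕ} (hn : 0 < n) (G : SimpleGraph (Fin n))
    {p c L : ℝ} (hp0 : 0 < p) (hp1 : p ≤ 1) (hL : Real.exp L = n) (hL1 : 1 ≤ L) (hc0 : 0 < c)
    (hc1 : c ≤ 1 / 100) (hcp : c * Real.log (2 / p) ≤ 1 / 100) (hcL : 1 ≤ c ^ 2 * L)
    (hexp : 2 * L ^ 2 * Real.exp (0.65 * L) < Real.exp (0.95 * L))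
    (hdens : ∀ U : Finset (Fin n), Real.exp (0.6 * L) ≤ U.card →
      p * (1 - 1 / (2 * L ^ 2)) * (U.card : ℝ) ^ 2 ≤ ∑ v ∈ U, ((G.neighborsIn U v).card : ℝ))
    (hcount : ∀ s : ℕ, (s : ℝ) ≤ L → ((G.orderedCliques s Finset.univ).card : ℝ)
      ≤ L ^ 2 * ((n : ℝ) ^ s * p ^ (s.choose 2))) :
    (G.cliqueCoverNumber : ℝ) ≤ (1 + 8 / c ^ 2) * (n : ℝ) ^ 2 / L ^ 2 := by
  have hn' : (0 : ℝ) < n := by exact_mod_cast hn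
  have hL0 : 0 < L := by linarith
  obtain ⟨F, hF1, hF2, hF3⟩ := exists_cover_of_greedy G (β := c ^ 2 * L ^ 2 / (4 * n))
    (T := (n : ℝ) ^ 2 / L ^ 2) (by positivity) (by positivity)
    (fun H hHG hT => by
      obtain ⟨K, hK, h⟩ := exists_clique_of_clique_counts hn hp0 hp1 hL hL1 hc0 hc1 hcp hcL hexp
        hdens hcount hHG hT
      exact ⟨K, hK, by convert h⟩) G le_rfl
  have hθ : G.cliqueCoverNumber ≤ F.card := Nat.sInf_le ⟨F, ⟨hF1, hF2⟩, rfl⟩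
  have hsqrt : Real.sqrt (G.adjPairs.card) ≤ n :=
    Real.sqrt_le_iff.2 ⟨hn'.le, card_adjPairs_le G⟩
  calc (G.cliqueCoverNumber : ℝ) ≤ F.card := by exact_mod_cast hθ
    _ ≤ (n : ℝ) ^ 2 / L ^ 2 + 2 / (c ^ 2 * L ^ 2 / (4 * n)) * Real.sqrt (G.adjPairs.card) := hF3
    _ ≤ (n : ℝ) ^ 2 / L ^ 2 + 2 / (c ^ 2 * L ^ 2 / (4 * n)) * n := by gcongr
    _ = (1 + 8 / c ^ 2) * (n : ℝ) ^ 2 / L ^ 2 := by field_simp; norm_num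

/-- Lower bound for the clique cover number of a dense graph with small cliques. -/
theorem le_cliqueCoverNumber_of_dense {n : ℕ} (G : SimpleGraph (Fin n)) {r C L : ℝ} {k : ℕ}
    (hL : 0 < L) (hC : 0 < C) (hk : (k : ℝ) ≤ C * L)
    (hdens : r * (n : ℝ) ^ 2 ≤ ∑ v, ((G.neighborsIn Finset.univ v).card : ℝ))
    (hempty : G.orderedCliques k Finset.univ = ∅) :
    r / C ^ 2 * (n : ℝ) ^ 2 / L ^ 2 ≤ (G.cliqueCoverNumber : ℝ) := by
  obtain ⟨F, hF, hcard⟩ := G.exists_isCliqueCover_card_eq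
  have h1 := adjPairs_card_le_of_isCliqueCover
    (fun K hK => (card_lt_of_orderedCliques_eq_empty hempty K hK).le) hF
  rw [hcard] at h1
  have h2 : (G.adjPairs.card : ℝ) ≤ G.cliqueCoverNumber * (k : ℝ) ^ 2 := by exact_mod_cast h1
  rw [← Nat.cast_sum, sum_card_neighborsIn] at hdens
  rw [div_mul_eq_mul_div, div_div, div_le_iff₀ (by positivity)]
  calc r * (n : ℝ) ^ 2 ≤ G.cliqueCoverNumber * (k : ℝ) ^ 2 := hdens.trans h2
    _ ≤ G.cliqueCoverNumber * (C * L) ^ 2 := by gcongr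
    _ = _ := by ring

end Deterministic

/-! ### Failure probabilities of the pseudo-random properties -/

section Asymptotics

open MeasureTheory

theorem eventually_const_mul_pow_lt_exp (K b : ℝ) (hb : 0 < b) (k : ℕ) :
    ∀ᶠ L : ℝ in atTop, K * L ^ k < Real.exp (b * L) := by
  have h := (isLittleO_pow_exp_pos_mul_atTop k hb).bound
    (show (0 : ℝ) < 1 / (2 * (|K| + 1)) by positivity)
  filter_upwards [h, eventually_ge_atTop 0] with L hL hL0
  rw [Real.norm_of_nonneg (by positivity), Real.norm_of_nonneg (Real.exp_pos _).le,
    one_div, inv_mul_eq_div, le_div_iff₀ (by positivity)] at hL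
  have h1 : K * L ^ k ≤ (|K| + 1) * L ^ k := by
    gcongr
    linarith [le_abs_self K]
  have := Real.exp_pos (b * L)
  linarith

/-- With high probability, all large vertex sets have the expected density. -/
theorem binomialRandom_real_density_compl_le {n : ℕ} (p : unitInterval) {L : ℝ}
    (hL : Real.exp L = n) (hL1 : 1 ≤ L) (h4 : 4 * L ^ 2 ≤ Real.exp (0.6 * L))
    (h5 : 512 * L ^ 4 ≤ p * Real.exp (0.2 * L)) :
    (binomialRandom (Fin n) p).real {G | ¬ ∀ U : Finset (Fin n), Real.exp (0.6 * L) ≤ U.card →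
      p * (1 - 1 / (2 * L ^ 2)) * (U.card : ℝ) ^ 2 ≤ ∑ v ∈ U, ((G.neighborsIn U v).card : ℝ)}
      ≤ Real.exp (-L) := by
  classical
  have hp0 := p.2.1
  set W := Finset.univ.filter fun U : Finset (Fin n) => Real.exp (0.6 * L) ≤ U.card with hW
  set ε : ℝ := 1 / (2 * L ^ 2) with hε
  have hεL : L ^ 2 * ε = 1 / 2 := by rw [hε]; field_simp
  have hε0 : 0 < ε := by positivity
  have hε1 : ε ≤ 1 := by nlinarith
  have hsub : {G : SimpleGraph (Fin n) | ¬ ∀ U : Finset (Fin n), Real.exp (0.6 * L) ≤ U.card →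
      p * (1 - ε) * (U.card : ℝ) ^ 2 ≤ ∑ v ∈ U, ((G.neighborsIn U v).card : ℝ)}
      ⊆ ⋃ U ∈ W, {G | ∑ v ∈ U, ((G.neighborsIn U v).card : ℝ)
        < p * (1 - ε) * (U.card : ℝ) ^ 2} := by
    intro G hG
    rw [Set.mem_ofPred_eq] at hG
    push Not at hG
    obtain ⟨U, hU, h⟩ := hG
    simp only [Set.mem_iUnion]
    exact ⟨U, by simp [hW, hU], h⟩
  -- A single set fails with probability at most e^(-2n), since |U|² ≥ n^1.2 beats n L⁴; this
  -- outweighs the at most 2^n ≤ e^n sets.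
  have hU : ∀ U ∈ W, (binomialRandom (Fin n) p).real {G | ∑ v ∈ U,
      ((G.neighborsIn U v).card : ℝ) < p * (1 - ε) * (U.card : ℝ) ^ 2}
      ≤ Real.exp (-(2 * Real.exp L)) := by
    intro U hU
    have hU' : Real.exp (0.6 * L) ≤ U.card := by simpa [hW] using hU
    refine (binomialRandom_real_lower_tail p U hε0 hε1 ?_).trans (Real.exp_le_exp.2 ?_)
    · calc (2 : ℝ) = ε * (4 * L ^ 2) := by linarith
        _ ≤ ε * U.card := by gcongr; exact h4.trans hU'
    · refine neg_le_neg ?_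
      have h6 : Real.exp (0.2 * L) * Real.exp L ≤ (U.card : ℝ) ^ 2 := by
        calc Real.exp (0.2 * L) * Real.exp L = Real.exp (0.6 * L) ^ 2 := by
              rw [← Real.exp_add, sq, ← Real.exp_add]; ring_nf
          _ ≤ _ := by gcongr
      have h7 : ε ^ 2 = 1 / (4 * L ^ 4) := by rw [hε]; field_simp; norm_num
      calc 2 * Real.exp L = (512 * L ^ 4) * Real.exp L / (256 * L ^ 4) := by field_simp; norm_num
        _ ≤ (p * Real.exp (0.2 * L)) * Real.exp L / (256 * L ^ 4) := by gcongr
        _ = p * (Real.exp (0.2 * L) * Real.exp L) / (256 * L ^ 4) := by ring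
        _ ≤ p * (U.card : ℝ) ^ 2 / (256 * L ^ 4) := by gcongr
        _ = p * ε ^ 2 * (U.card : ℝ) ^ 2 / 64 := by rw [h7]; field_simp; ring
  have hWcard : (W.card : ℝ) ≤ Real.exp (Real.exp L) := by
    have h1 : W.card ≤ 2 ^ n := by
      refine (Finset.card_le_univ _).trans ?_
      simp
    have h2 : (2 : ℝ) ≤ Real.exp 1 := by have := Real.add_one_le_exp (1 : ℝ); linarith
    calc (W.card : ℝ) ≤ 2 ^ n := by exact_mod_cast h1
      _ ≤ Real.exp 1 ^ n := by gcongr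
      _ = Real.exp (Real.exp L) := by rw [← Real.exp_nat_mul, hL, mul_one]
  calc _ ≤ (binomialRandom (Fin n) p).real (⋃ U ∈ W, {G | ∑ v ∈ U,
        ((G.neighborsIn U v).card : ℝ) < p * (1 - ε) * (U.card : ℝ) ^ 2}) :=
        measureReal_mono hsub (measure_ne_top _ _)
    _ ≤ ∑ U ∈ W, (binomialRandom (Fin n) p).real {G | ∑ v ∈ U,
        ((G.neighborsIn U v).card : ℝ) < p * (1 - ε) * (U.card : ℝ) ^ 2} :=
        measureReal_biUnion_finset_le _ _
    _ ≤ ∑ U ∈ W, Real.exp (-(2 * Real.exp L)) := Finset.sum_le_sum hU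
    _ = W.card * Real.exp (-(2 * Real.exp L)) := by rw [Finset.sum_const, nsmul_eq_mul]
    _ ≤ Real.exp (Real.exp L) * Real.exp (-(2 * Real.exp L)) := by gcongr
    _ = Real.exp (- Real.exp L) := by rw [← Real.exp_add]; ring_nf
    _ ≤ Real.exp (-L) := by
      refine Real.exp_le_exp.2 (neg_le_neg ?_)
      linarith [Real.add_one_le_exp L]

/-- With high probability, the clique counts do not much exceed their expectations. -/
theorem binomialRandom_real_counts_compl_le {n : ℕ} (p : unitInterval) (hp : 0 < p) (hn : 0 < n)
    {L : ℝ} (hL1 : 1 ≤ L) :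
    (binomialRandom (Fin n) p).real {G | ¬ ∀ s : ℕ, (s : ℝ) ≤ L →
      ((G.orderedCliques s Finset.univ).card : ℝ) ≤ L ^ 2 * ((n : ℝ) ^ s * p ^ (s.choose 2))}
      ≤ 2 / L := by
  have hp0 : (0 : ℝ) < p := hp
  have hn' : (0 : ℝ) < n := by exact_mod_cast hn
  have hsub : {G : SimpleGraph (Fin n) | ¬ ∀ s : ℕ, (s : ℝ) ≤ L →
      ((G.orderedCliques s Finset.univ).card : ℝ) ≤ L ^ 2 * ((n : ℝ) ^ s * p ^ (s.choose 2))}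
      ⊆ ⋃ s ∈ Finset.range (⌊L⌋₊ + 1), {G | L ^ 2 * ((n : ℝ) ^ s * p ^ (s.choose 2)) <
        ((G.orderedCliques s Finset.univ).card : ℝ)} := by
    intro G hG
    rw [Set.mem_ofPred_eq] at hG
    push Not at hG
    obtain ⟨s, hs, h⟩ := hG
    simp only [Set.mem_iUnion]
    exact ⟨s, Finset.mem_range.2 (Nat.lt_succ_of_le (Nat.le_floor hs)), h⟩
  -- The slack L² over the first moment makes each failure at most 1/L², small enough for a union
  -- over at most 2L lengths.
  have hs : ∀ s ∈ Finset.range (⌊L⌋₊ + 1), (binomialRandom (Fin n) p).real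
      {G | L ^ 2 * ((n : ℝ) ^ s * p ^ (s.choose 2)) <
        ((G.orderedCliques s Finset.univ).card : ℝ)} ≤ 1 / L ^ 2 := by
    intro s _
    have h := (mul_binomialRandom_real_le (V := Fin n) p
      {G | L ^ 2 * ((n : ℝ) ^ s * p ^ (s.choose 2)) <
        ((G.orderedCliques s Finset.univ).card : ℝ)}
      (fun G => ((G.orderedCliques s Finset.univ).card : ℝ))
      (L ^ 2 * ((n : ℝ) ^ s * p ^ (s.choose 2))) (fun _ => Nat.cast_nonneg _)
      (fun G hG => le_of_lt hG)).trans
      (sum_binomialRandom_real_mul_card_orderedCliques_le p s)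
    rw [Fintype.card_fin] at h
    have hpos : 0 < (n : ℝ) ^ s * (p : ℝ) ^ (s.choose 2) := by positivity
    rw [le_div_iff₀ (by positivity)]
    refine le_of_mul_le_mul_right ?_ hpos
    linarith
  calc _ ≤ _ := measureReal_mono hsub (measure_ne_top _ _)
    _ ≤ _ := measureReal_biUnion_finset_le _ _
    _ ≤ ∑ s ∈ Finset.range (⌊L⌋₊ + 1), 1 / L ^ 2 := Finset.sum_le_sum hs
    _ = (⌊L⌋₊ + 1) * (1 / L ^ 2) := by simp
    _ ≤ (L + L) * (1 / L ^ 2) := by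
      gcongr
      exact Nat.floor_le (by linarith)
    _ = 2 / L := by field_simp; norm_num

/-- With high probability, all cliques have logarithmic size. -/
theorem binomialRandom_real_large_clique_le {n : ℕ} (p : unitInterval) (hp0 : 0 < p)
    {L : ℝ} (hL : Real.exp L = n) (hL1 : 1 ≤ L) {k : ℕ} (hk1 : 1 ≤ k)
    (hk : 4 * L ≤ -Real.log p * (k - 1)) :
    (binomialRandom (Fin n) p).real {G | G.orderedCliques k Finset.univ ≠ ∅}
      ≤ Real.exp (-L) := by
  have hp0' : (0 : ℝ) < p := hp0
  have hk1' : (1 : ℝ) ≤ k := by exact_mod_cast hk1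
  have h := (mul_binomialRandom_real_le (V := Fin n) p {G | G.orderedCliques k Finset.univ ≠ ∅}
    (fun G => ((G.orderedCliques k Finset.univ).card : ℝ)) 1 (fun _ => Nat.cast_nonneg _)
    (fun G hG => by
      have := Finset.card_pos.2 (Finset.nonempty_iff_ne_empty.2 hG)
      exact_mod_cast this)).trans
    (sum_binomialRandom_real_mul_card_orderedCliques_le p k)
  rw [one_mul, Fintype.card_fin, ← hL] at h
  refine h.trans ?_
  have h1 : (p : ℝ) ^ (k.choose 2) = Real.exp ((k.choose 2 : ℕ) * Real.log p) := by
    rw [Real.exp_nat_mul, Real.exp_log hp0']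
  rw [h1, ← Real.exp_nat_mul, ← Real.exp_add, Nat.cast_choose_two]
  refine Real.exp_le_exp.2 ?_
  -- This gives p^(k choose 2) ≤ e^(-2kL), so the expectation is at most e^(kL - 2kL) ≤ e^(-L).
  have h2 := mul_le_mul_of_nonneg_left hk (by linarith : (0 : ℝ) ≤ k / 2)
  nlinarith

end Asymptotics

end SimpleGraph

/-! ### Choice of constants and assembly -/

theorem theorem1 (p : unitInterval) (hp0 : 0 < p) (hp1 : p < 1) :
    ∃ c₁ c₂ : ℝ, 0 < c₁ ∧ 0 < c₂ ∧
      Tendsto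
        (fun n : ℕ =>
          SimpleGraph.binomialRandom (Fin n) p
            {G : SimpleGraph (Fin n) |
              c₁ * (n : ℝ) ^ 2 / (Real.log n) ^ 2 ≤ (G.cliqueCoverNumber : ℝ) ∧
              (G.cliqueCoverNumber : ℝ) ≤ c₂ * (n : ℝ) ^ 2 / (Real.log n) ^ 2})
        atTop (𝓝 1) := by
  have hp0' : (0 : ℝ) < p := hp0
  have hp1' : (p : ℝ) < 1 := hp1
  have hlam : 0 < -Real.log p := neg_pos.2 (Real.log_neg hp0' hp1')
  have hlog2 : 0 < Real.log (2 / p) := Real.log_pos (by rw [lt_div_iff₀ hp0']; linarith)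
  -- The summand 2 absorbs the rounding and the extra 1 in k, as L ≥ 1. The constant c below is
  -- small enough that both c and c log(2/p) are at most 1/100.
  set C : ℝ := 4 / -Real.log p + 2 with hC
  set c : ℝ := 1 / (100 * (1 + Real.log (2 / p))) with hc
  have hC0 : 0 < C := by positivity
  have hc0 : 0 < c := by positivity
  have hcmul : c * (1 + Real.log (2 / p)) = 1 / 100 := by rw [hc]; field_simp
  have hc1 : c ≤ 1 / 100 := by nlinarith
  have hcp : c * Real.log (2 / p) ≤ 1 / 100 := by linarith
  refine ⟨p / 2 / C ^ 2, 1 + 8 / c ^ 2, by positivity, by positivity, ?_⟩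
  have hlog : Tendsto (fun n : ℕ => Real.log n) atTop atTop :=
    Real.tendsto_log_atTop.comp tendsto_natCast_atTop_atTop
  have hev : ∀ᶠ L : ℝ in atTop, 1 ≤ L ∧ 1 ≤ c ^ 2 * L ∧
      2 * L ^ 2 * Real.exp (0.65 * L) < Real.exp (0.95 * L) ∧
      4 * L ^ 2 ≤ Real.exp (0.6 * L) ∧ 512 * L ^ 4 ≤ p * Real.exp (0.2 * L) := by
    filter_upwards [eventually_ge_atTop 1, eventually_ge_atTop (1 / c ^ 2),
      SimpleGraph.eventually_const_mul_pow_lt_exp 2 0.3 (by norm_num) 2,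
      SimpleGraph.eventually_const_mul_pow_lt_exp 4 0.6 (by norm_num) 2,
      SimpleGraph.eventually_const_mul_pow_lt_exp (512 / p) 0.2 (by norm_num) 4]
      with L h1 h2 h3 h4 h5
    refine ⟨h1, ?_, ?_, h4.le, ?_⟩
    · rw [div_le_iff₀ (by positivity)] at h2; linarith
    · calc 2 * L ^ 2 * Real.exp (0.65 * L) < Real.exp (0.3 * L) * Real.exp (0.65 * L) := by gcongr
        _ = Real.exp (0.95 * L) := by rw [← Real.exp_add]; ring_nf
    · rw [div_mul_eq_mul_div, div_lt_iff₀ hp0'] at h5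
      linarith
  have hlower : ∀ᶠ n : ℕ in atTop,
      1 - (Real.exp (-Real.log n) + 2 / Real.log n + Real.exp (-Real.log n)) ≤
        (SimpleGraph.binomialRandom (Fin n) p).real
            {G : SimpleGraph (Fin n) |
              p / 2 / C ^ 2 * (n : ℝ) ^ 2 / (Real.log n) ^ 2 ≤ (G.cliqueCoverNumber : ℝ) ∧
              (G.cliqueCoverNumber : ℝ)
                ≤ (1 + 8 / c ^ 2) * (n : ℝ) ^ 2 / (Real.log n) ^ 2} := by
    filter_upwards [hlog.eventually hev, eventually_gt_atTop 0] with n hn hn0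
    obtain ⟨hL1, hcL, hexp, h4, h5⟩ := hn
    have hL : Real.exp (Real.log n) = n := Real.exp_log (by exact_mod_cast hn0)
    set L := Real.log n with hLdef
    set k : ℕ := ⌈4 * L / -Real.log p⌉₊ + 1 with hk
    have hk1 : 4 * L / -Real.log p ≤ (k : ℝ) - 1 := by
      have := Nat.le_ceil (4 * L / -Real.log p)
      rw [hk]; push_cast; linarith
    have hk2 : (k : ℝ) ≤ C * L := by
      have := Nat.ceil_lt_add_one (show 0 ≤ 4 * L / -Real.log p by positivity)
      have h' : C * L = 4 * L / -Real.log p + 2 * L := by rw [hC]; ring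
      rw [hk, h']; push_cast; linarith
    have hA := SimpleGraph.binomialRandom_real_density_compl_le p hL hL1 h4 h5
    have hB := SimpleGraph.binomialRandom_real_counts_compl_le p hp0 hn0 hL1
    have hD := SimpleGraph.binomialRandom_real_large_clique_le p hp0 hL hL1 (k := k)
      (by omega) (by rwa [div_le_iff₀' hlam] at hk1)
    set A := {G : SimpleGraph (Fin n) | ¬ ∀ U : Finset (Fin n), Real.exp (0.6 * L) ≤ U.card →
      p * (1 - 1 / (2 * L ^ 2)) * (U.card : ℝ) ^ 2 ≤ ∑ v ∈ U, ((G.neighborsIn U v).card : ℝ)}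
    set B := {G : SimpleGraph (Fin n) | ¬ ∀ s : ℕ, (s : ℝ) ≤ L →
      ((G.orderedCliques s Finset.univ).card : ℝ) ≤ L ^ 2 * ((n : ℝ) ^ s * p ^ (s.choose 2))}
    set D := {G : SimpleGraph (Fin n) | G.orderedCliques k Finset.univ ≠ ∅}
    set S := {G : SimpleGraph (Fin n) |
              p / 2 / C ^ 2 * (n : ℝ) ^ 2 / L ^ 2 ≤ (G.cliqueCoverNumber : ℝ) ∧
              (G.cliqueCoverNumber : ℝ) ≤ (1 + 8 / c ^ 2) * (n : ℝ) ^ 2 / L ^ 2}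
    -- Outside the three bad events both bounds hold. The lower one uses the density property for
    -- the whole vertex set.
    have hcover : Set.univ ⊆ A ∪ B ∪ D ∪ S := by
      intro G _
      by_contra hG
      simp only [Set.mem_union, not_or] at hG
      obtain ⟨⟨⟨hGA, hGB⟩, hGD⟩, hGS⟩ := hG
      have hGA := not_not.1 hGA
      have hGB := not_not.1 hGB
      have hGD := not_not.1 hGD
      refine hGS ⟨?_, ?_⟩
      · refine SimpleGraph.le_cliqueCoverNumber_of_dense G (by linarith) hC0 hk2 ?_ hGD
        have hd := hGA Finset.univ (by
          rw [Finset.card_univ, Fintype.card_fin, ← hL]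
          exact Real.exp_le_exp.2 (by linarith))
        rw [Finset.card_univ, Fintype.card_fin] at hd
        refine le_trans ?_ hd
        have : 1 / (2 * L ^ 2) ≤ 1 / 2 := by
          apply one_div_le_one_div_of_le <;> nlinarith
        have h2 : (p : ℝ) / 2 ≤ p * (1 - 1 / (2 * L ^ 2)) := by nlinarith
        gcongr
      · exact SimpleGraph.cliqueCoverNumber_le_of_clique_counts hn0 G hp0' hp1'.le hL hL1 hc0
          hc1 hcp hcL hexp hGA hGB
    have h1 : (1 : ℝ) ≤ (SimpleGraph.binomialRandom (Fin n) p).real (A ∪ B ∪ D ∪ S) := by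
      rw [← MeasureTheory.probReal_univ (μ := SimpleGraph.binomialRandom (Fin n) p)]
      exact MeasureTheory.measureReal_mono hcover
    have h2 := MeasureTheory.measureReal_union_le (μ := SimpleGraph.binomialRandom (Fin n) p)
      (A ∪ B ∪ D) S
    have h3 := MeasureTheory.measureReal_union_le (μ := SimpleGraph.binomialRandom (Fin n) p)
      (A ∪ B) D
    have h4 := MeasureTheory.measureReal_union_le (μ := SimpleGraph.binomialRandom (Fin n) p) A B
    linarith
  have hlim : Tendsto (fun n : ℕ =>
      1 - (Real.exp (-Real.log n) + 2 / Real.log n + Real.exp (-Real.log n))) atTop (𝓝 1) := by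
    have h1 : Tendsto (fun n : ℕ => Real.exp (-Real.log n)) atTop (𝓝 0) :=
      Real.tendsto_exp_neg_atTop_nhds_zero.comp hlog
    have h2 : Tendsto (fun n : ℕ => 2 / Real.log n) atTop (𝓝 0) :=
      hlog.const_div_atTop 2
    simpa using ((h1.add h2).add h1).const_sub 1
  have hreal := tendsto_of_tendsto_of_tendsto_of_le_of_le' hlim tendsto_const_nhds hlower
    (Eventually.of_forall fun n => MeasureTheory.measureReal_le_one)
  have hfinal := ENNReal.tendsto_ofReal hreal
  rw [ENNReal.ofReal_one] at hfinal
  refine hfinal.congr fun n => ?_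
  exact MeasureTheory.ofReal_measureReal
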